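/- There are absolute constants $C_1, C_2$ such that the following holds. Let $p$ be a prime, $\mathbb{F}=\mathbb{F}_p$, $n\in\mathbb{N}$, and let $f\in\mathbb{F}[x_1,\dots,x_n]$ be a cubic polynomial ($\deg f=3$). Put $\omega=e^{2\pi i/p}$ and let $$\delta=\mathrm{bias}(f)=\Bigl|\,p^{-n}\sum_{a\in\mathbb{F}^n}\omega^{f(a)}\Bigr| ,$$ and assume $\delta>0$. Then there exist natural numbers $c_1\le C_1\log(1/\delta)$ and $c_2\le C_2\log^4(1/\delta)$, polynomials $\ell_1,\dots,\ell_{c_1},\ell'_1,\dots,\ell'_{c_2}\in\mathbb{F}[x_1,\dots,x_n]$ that are linear (of degree at most $1$, constant terms allowed), polynomials $q_1,\dots,q_{c_1}\in\mathbb{F}[x_1,\dots,x_n]$ that are quadratic (of degree at most $2$), and a cubic polynomial $g\in\mathbb{F}[y_1,\dots,y_{c_2}]$ (of degree at most $3$) such that $$f=\sum_{j=1}^{c_1}\ell_j\cdot q_j+g(\ell'_1,\dots,\ell'_{c_2})$$ as functions $\mathbb{F}^n\to\mathbb{F}$. -/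

import Mathlib

/-- The bias of a function `F : 𝔽_p^n → 𝔽_p`: the absolute value of the average of `ω ^ F(a)` over
all `a ∈ 𝔽_p^n`, where `ω = exp(2πi/p)`. -/
noncomputable def bias {p n : ℕ} [Fact p.Prime] (F : (Fin n → ZMod p) → ZMod p) : ℝ :=
  ‖(∑ a : Fin n → ZMod p, Complex.exp (2 * Real.pi * Complex.I / p) ^ (F a).val) / (p : ℂ) ^ n‖

/-! The third difference of `f` is a trilinear form `T`. Two van der Corput steps turn bias δ into
at least δ⁴N² pairs `(h, y)`, N being the number of points, with `T h y = 0` (`bias_pow_four_le`),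
so `T h` has rank O(log(1/δ)) for a dense set of `h`. The structural core,
`LinearMap.exists_submodules_of_rank_le`, shows that such a `T` maps `U × K` into a small space `L`.
Passing to the annihilator of `L` inside `K`, `T` vanishes on `U × K × K` with codim `K` =
O(log(1/δ)) and codim `U` = O(log²(1/δ)).

The core lemma combines two facts. A random subspace of dimension slightly above the logarithm of
the inverse density of a set meets it in almost every coset (`exists_submodule_card_uncovered_le`).
And if `N` and `N + M` have rank at most ρ while `M` has rank at least ρ, then `N`, restricted to
`ker M` and reduced modulo `range M`, has rank at most ρ/2
(`LinearMap.finrank_range_add_two_mul_le`). Induction on ρ halves the rank while the auxiliary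
subspace roughly doubles in dimension, so codim `U` grows only quadratically.

Finally, some coset of `K` retains bias δ. On it, derivatives along `U ∩ K` are affine, and bias
forces invariance under a subspace `R` of bounded codimension (`exists_invariant_submodule`).
Leaving the coset costs codim `K` products; on the coset, `f` is a cubic in codim `R` affine
functions. The number of these is O(log²(1/δ)), better than the required fourth power. -/

open Module

/-! ### Rank inequalities over a field -/

section LinearAlgebra

variable {F X Y Z : Type*} [Field F] [AddCommGroup X] [Module F X] [AddCommGroup Y] [Module F Y]
  [AddCommGroup Z] [Module F Z]

theorem Submodule.finrank_map_mkQ_add_finrank_inf [FiniteDimensional F Z] (V S : Submodule F Z) :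
    finrank F (S.map V.mkQ) + finrank F (V ⊓ S : Submodule F Z) = finrank F S := by
  have h := LinearMap.finrank_range_add_finrank_ker (V.mkQ.domRestrict S)
  have h1 : LinearMap.range (V.mkQ.domRestrict S) = S.map V.mkQ := by
    rw [LinearMap.range_domRestrict]
  have h2 : finrank F (LinearMap.ker (V.mkQ.domRestrict S)) = finrank F (V ⊓ S : Submodule F Z) := by
    have : (LinearMap.ker (V.mkQ.domRestrict S)).map S.subtype = V ⊓ S := by
      ext x
      simp [LinearMap.domRestrict_apply]
    rw [← this, Submodule.finrank_map_subtype_eq]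
  rw [h1, h2] at h
  exact h

/-- The space `V = N(ker M)` lies in the ranges of both `N` and `N + M`, while modulo `V` the range
of `M` lies in the sum of those two ranges. Hence dim `V` is saved twice, and the compressed rank is
dim `V` − dim(`V ∩ range M`). -/
theorem LinearMap.finrank_range_add_two_mul_le [FiniteDimensional F Z] (M N : Y →ₗ[F] Z) :
    finrank F (range M) + 2 * finrank F (range ((range M).mkQ ∘ₗ N ∘ₗ (ker M).subtype)) ≤
      finrank F (range N) + finrank F (range (N + M)) := by
  set V : Submodule F Z := (ker M).map N with hV
  have hr : range ((range M).mkQ ∘ₗ N ∘ₗ (ker M).subtype) = V.map (range M).mkQ := by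
    rw [range_comp, range_comp, Submodule.range_subtype]
  have hN : V ≤ range N := LinearMap.map_le_range
  have hP : V ≤ range (N + M) := by
    rintro _ ⟨y, hy, rfl⟩
    exact ⟨y, by simpa using hy⟩
  have e1 := Submodule.finrank_map_mkQ_add_finrank_inf V (range N)
  have e2 := Submodule.finrank_map_mkQ_add_finrank_inf V (range (N + M))
  have e3 := Submodule.finrank_map_mkQ_add_finrank_inf V (range M)
  have e4 := Submodule.finrank_map_mkQ_add_finrank_inf (range M) V
  rw [inf_eq_left.2 hN] at e1
  rw [inf_eq_left.2 hP] at e2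
  rw [inf_comm] at e4
  have sub : (range M).map V.mkQ ≤ (range (N + M)).map V.mkQ ⊔ (range N).map V.mkQ := by
    rintro _ ⟨_, ⟨y, rfl⟩, rfl⟩
    have : V.mkQ (M y) = V.mkQ ((N + M) y) + V.mkQ (-(N y)) := by rw [← map_add]; simp
    rw [this]
    exact Submodule.add_mem_sup (Submodule.mem_map_of_mem ⟨y, rfl⟩)
      (Submodule.mem_map_of_mem ⟨-y, by simp⟩)
  have s1 := Submodule.finrank_mono sub
  have s2 := Submodule.finrank_add_le_finrank_add_finrank
    ((range (N + M)).map V.mkQ) ((range N).map V.mkQ)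
  rw [hr]
  omega

theorem LinearMap.finrank_range_sub_le [FiniteDimensional F Z] (M N : Y →ₗ[F] Z) :
    finrank F (range (M - N)) ≤ finrank F (range M) + finrank F (range N) := by
  have sub : range (M - N) ≤ range M ⊔ range N := by
    rintro _ ⟨y, rfl⟩
    rw [sub_apply, sub_eq_add_neg]
    exact Submodule.add_mem_sup ⟨y, rfl⟩ ⟨-y, by simp⟩
  exact (Submodule.finrank_mono sub).trans (Submodule.finrank_add_le_finrank_add_finrank _ _)

theorem Submodule.two_mul_card_le_of_ne_top [Finite F] [Finite X] {W : Submodule F X}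
    (hW : W ≠ ⊤) : 2 * Nat.card W ≤ Nat.card X := by
  have : FiniteDimensional F X := Module.Finite.of_finite
  rw [Module.natCard_eq_pow_finrank (K := F) (V := X),
    Module.natCard_eq_pow_finrank (K := F) (V := W)]
  calc _ ≤ Nat.card F * Nat.card F ^ finrank F W :=
        Nat.mul_le_mul_right _ Finite.one_lt_card
    _ = Nat.card F ^ (finrank F W + 1) := (pow_succ' _ _).symm
    _ ≤ _ := Nat.pow_le_pow_right Nat.card_pos (Submodule.finrank_lt hW)

end LinearAlgebra

/-! ### Random subspaces meeting most translates of a dense set -/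

section Covering

open Finset

/-- All fibres of a surjective homomorphism have the same size, so it pushes uniform measure to
uniform measure. -/
theorem AddMonoidHom.card_mul_card_filter_mem {G H : Type*} [AddGroup G] [AddGroup H] [Fintype G]
    [Fintype H] [DecidableEq H] (φ : G →+ H) (hφ : Function.Surjective φ) (S : Finset H) :
    Fintype.card H * #{g | φ g ∈ S} = #S * Fintype.card G := by
  classical
  have fib (y : H) : #{g | φ g = y} = #{g | φ g = 0} :=
    AddMonoidHom.card_fiber_eq_of_mem_range φ (hφ y) (hφ 0)
  have h (S : Finset H) : #{g | φ g ∈ S} = #S * #{g | φ g = 0} := by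
    have := card_eq_sum_card_fiberwise (s := ({g | φ g ∈ S} : Finset G)) (f := φ) (t := S)
      (by intro g hg; simpa using hg)
    rw [this, ← smul_eq_mul, ← sum_const]
    refine sum_congr rfl fun y hy => ?_
    rw [← fib y, filter_filter]
    congr 1
    ext g
    simp only [mem_filter, mem_univ, true_and]
    exact ⟨fun h => h.2, fun h => ⟨h ▸ hy, h⟩⟩
  have hu := h univ
  simp only [mem_univ, filter_true] at hu
  rw [h S, ← Finset.card_univ (α := G), hu, Finset.card_univ]
  ring

variable {F X : Type*} [Field F] [Fintype F] [AddCommGroup X] [Module F X] [Fintype X]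
  [DecidableEq X]

/-- A second moment argument: few cosets of a random subspace miss a given dense set. -/
theorem exists_tuple_card_uncovered_le (A : Finset X) (t : ℕ) :
    ∃ x : Fin t → X, Fintype.card F ^ t * #A * #{y | ∀ c : Fin t → F, y + ∑ i, c i • x i ∉ A} ≤
      Fintype.card X ^ 2 := by
  classical
  rcases A.eq_empty_or_nonempty with rfl | hA
  · exact ⟨0, by simp⟩
  set N := Fintype.card X with hN
  have hN0 : 0 < N := Fintype.card_pos
  let φ (c : Fin t → F) : (Fin t → X) × X →+ X :=
    AddMonoidHom.mk' (fun z => z.2 + ∑ i, c i • z.1 i) (by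
      intro a b
      simp only [Prod.snd_add, Prod.fst_add, Pi.add_apply, smul_add, sum_add_distrib]
      abel)
  have φ_def (c z) : φ c z = z.2 + ∑ i, c i • z.1 i := rfl
  set P := Fintype.card ((Fin t → X) × X) with hP
  have hPN : P = N ^ t * N := by simp [hP, hN]
  have one (c : Fin t → F) : N * #{z | φ c z ∈ A} = #A * P :=
    (φ c).card_mul_card_filter_mem (fun y => ⟨(0, y), by simp [φ_def]⟩) A
  -- Pairwise independence: for `c ≠ d` the pair `(φ c, φ d)` is onto `X × X`. A coordinate where
  -- `c` and `d` differ suffices to solve for a preimage.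
  have two (c d : Fin t → F) (hcd : c ≠ d) :
      N * N * #{z | φ c z ∈ A ∧ φ d z ∈ A} = #A * #A * P := by
    have := ((φ c).prod (φ d)).card_mul_card_filter_mem (by
      rintro ⟨a, b⟩
      obtain ⟨i, hi⟩ := Function.ne_iff.1 hcd
      have hi' : c i - d i ≠ 0 := sub_ne_zero.2 hi
      refine ⟨(Pi.single i ((c i - d i)⁻¹ • (a - b)), a - c i • ((c i - d i)⁻¹ • (a - b))), ?_⟩
      have (e : Fin t → F) (v : X) : ∑ j, e j • (Pi.single i v : Fin t → X) j = e i • v := by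
        rw [sum_eq_single i] <;> simp +contextual [Pi.single_eq_of_ne]
      simp only [AddMonoidHom.prod_apply, φ_def, this]
      ext
      · simp
      · simp only
        have h : c i • (c i - d i)⁻¹ • (a - b) = d i • (c i - d i)⁻¹ • (a - b) + (a - b) := by
          rw [← sub_eq_iff_eq_add', ← sub_smul, smul_smul, mul_inv_cancel₀ hi', one_smul]
        rw [h]; abel) (A ×ˢ A)
    simp only [card_product, mem_product, AddMonoidHom.prod_apply] at this
    rwa [Fintype.card_prod X X] at this
  set Q := Fintype.card F ^ t with hQ
  have hQ0 : 0 < Q := pow_pos Fintype.card_pos _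
  have hQc : Fintype.card (Fin t → F) = Q := by simp [hQ]
  let Zf (z : (Fin t → X) × X) : ℝ := ∑ c : Fin t → F, if φ c z ∈ A then 1 else 0
  have hN0' : (0 : ℝ) < N := by exact_mod_cast hN0
  have hA0 : (0 : ℝ) < #A := by exact_mod_cast hA.card_pos
  have hQ0' : (0 : ℝ) < Q := by exact_mod_cast hQ0
  set μ : ℝ := Q * #A / N with hμ
  have hμ0 : 0 < μ := by positivity
  have sumZ : ∑ z, Zf z = μ * P := by
    simp only [Zf]
    rw [sum_comm]
    have h (c : Fin t → F) : ∑ z, (if φ c z ∈ A then (1 : ℝ) else 0) = #A * P / N := by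
      rw [sum_boole, eq_div_iff hN0'.ne', mul_comm]
      exact_mod_cast one c
    simp only [h, sum_const, Finset.card_univ, hQc, nsmul_eq_mul, hμ]
    ring
  have sumZ2 : ∑ z, Zf z ^ 2 ≤ μ * P + μ ^ 2 * P := by
    have h (c d : Fin t → F) : ∑ z, ((if φ c z ∈ A then (1 : ℝ) else 0) * if φ d z ∈ A then 1 else 0)
        ≤ (if c = d then (#A * P / N : ℝ) else 0) + #A * #A * P / (N * N) := by
      have e (z) : ((if φ c z ∈ A then (1 : ℝ) else 0) * if φ d z ∈ A then 1 else 0) =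
          if φ c z ∈ A ∧ φ d z ∈ A then 1 else 0 := by
        by_cases h1 : φ c z ∈ A <;> by_cases h2 : φ d z ∈ A <;> simp [h1, h2]
      simp only [e, sum_boole]
      split_ifs with hcd
      · subst hcd
        have : (#{z | φ c z ∈ A ∧ φ c z ∈ A} : ℝ) = #A * P / N := by
          simp only [and_self]
          rw [eq_div_iff hN0'.ne', mul_comm]
          exact_mod_cast one c
        rw [this]
        have : (0 : ℝ) ≤ #A * #A * P / (N * N) := by positivity
        linarith
      · rw [zero_add, le_div_iff₀ (by positivity), mul_comm]
        exact_mod_cast (two c d hcd).le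
    calc ∑ z, Zf z ^ 2 = ∑ c : Fin t → F, ∑ d : Fin t → F,
          ∑ z, ((if φ c z ∈ A then (1 : ℝ) else 0) * if φ d z ∈ A then 1 else 0) := by
          simp only [Zf, sq, sum_mul_sum]
          rw [sum_comm]
          exact sum_congr rfl fun c _ => sum_comm
      _ ≤ ∑ c : Fin t → F, ∑ d : Fin t → F,
          ((if c = d then (#A * P / N : ℝ) else 0) + #A * #A * P / (N * N)) :=
          sum_le_sum fun c _ => sum_le_sum fun d _ => h c d
      _ = μ * P + μ ^ 2 * P := by
          simp only [sum_add_distrib, sum_ite_eq, mem_univ, if_true, sum_const, Finset.card_univ,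
            hQc, nsmul_eq_mul, hμ]
          ring
  let B : Finset ((Fin t → X) × X) := {z | ∀ c, φ c z ∉ A}
  -- Chebyshev: the count `Zf` has mean μ and variance at most μ, and it vanishes on `B`.
  have cheb : μ ^ 2 * #B ≤ μ * P := by
    calc μ ^ 2 * #B = ∑ z ∈ B, (Zf z - μ) ^ 2 := by
          rw [mul_comm, ← nsmul_eq_mul, ← sum_const]
          refine sum_congr rfl fun z hz => ?_
          have hz' : ∀ c, φ c z ∉ A := by simpa [B] using hz
          simp [Zf, hz']
      _ ≤ ∑ z, (Zf z - μ) ^ 2 := sum_le_univ_sum_of_nonneg fun z => sq_nonneg _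
      _ = ∑ z, Zf z ^ 2 - 2 * μ * ∑ z, Zf z + μ ^ 2 * P := by
          simp only [sub_sq, sum_add_distrib, sum_sub_distrib, sum_const, Finset.card_univ,
            nsmul_eq_mul, ← hP, mul_sum]
          congr 1
          · congr 1
            exact sum_congr rfl fun z _ => by ring
          · ring
      _ ≤ μ * P := by rw [sumZ]; linarith
  have cheb' : Q * #A * #B ≤ N * P := by
    have h1 : μ * #B ≤ P := by
      have : μ * (μ * #B) ≤ μ * P := by rw [← mul_assoc, ← sq]; exact cheb
      exact le_of_mul_le_mul_left this hμ0
    have h2 : (Q * #A * #B : ℝ) ≤ N * P := by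
      rw [hμ, div_mul_eq_mul_div, div_le_iff₀ hN0'] at h1
      linarith
    exact_mod_cast h2
  have hB : #B = ∑ x : Fin t → X, #{y | ∀ c : Fin t → F, y + ∑ i, c i • x i ∉ A} := by
    simp only [B, card_filter, φ_def]
    rw [← univ_product_univ, sum_product]
  by_contra! hcon
  have : ∑ _x : Fin t → X, N ^ 2 <
      ∑ x : Fin t → X, Q * #A * #{y | ∀ c : Fin t → F, y + ∑ i, c i • x i ∉ A} :=
    sum_lt_sum_of_nonempty univ_nonempty fun x _ => hcon x
  rw [← mul_sum, ← hB, sum_const, Finset.card_univ, Fintype.card_fun, Fintype.card_fin,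
    smul_eq_mul, ← hN] at this
  rw [hPN] at cheb'
  have e : N * (N ^ t * N) = N ^ t * N ^ 2 := by ring
  exact absurd (e ▸ cheb') (not_le.2 this)

theorem exists_submodule_card_uncovered_le (A : Finset X) (t : ℕ) :
    ∃ V : Submodule F X, finrank F V ≤ t ∧
      ∀ B : Finset X, (∀ y ∈ B, ∀ v ∈ V, y + v ∉ A) →
        Fintype.card F ^ t * #A * #B ≤ Fintype.card X ^ 2 := by
  obtain ⟨x, hx⟩ := exists_tuple_card_uncovered_le (F := F) A t
  refine ⟨Submodule.span F (Set.range x), ?_, fun B hB => le_trans ?_ hx⟩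
  · exact (finrank_range_le_card (R := F) x).trans (Fintype.card_fin t).le
  · gcongr
    intro y hy
    simp only [mem_filter, mem_univ, true_and]
    exact fun c => hB y hy _ (Submodule.sum_mem _ fun i _ =>
      Submodule.smul_mem _ _ (Submodule.subset_span ⟨i, rfl⟩))

end Covering

/-! ### Families of low-rank maps, by halving the rank -/

section LowRank

open Finset

universe u v

open Classical in
/-- If most slices of `T : X → Hom(Y, Z)` have small rank modulo slices from a small subspace `W`,
then `T` vanishes on large subspaces modulo a small subspace of the target. -/
theorem LinearMap.exists_submodules_of_rank_le {F X : Type*} [Field F] [Fintype F]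
    [AddCommGroup X] [Module F X] [Fintype X] (ρ : ℕ) :
    ∀ {Y : Type u} {Z : Type v} [AddCommGroup Y] [Module F Y] [AddCommGroup Z] [Module F Z]
      [FiniteDimensional F Y] [FiniteDimensional F Z] (T : X →ₗ[F] Y →ₗ[F] Z) (W : Submodule F X),
      7 * Fintype.card X ≤ 8 * #{u | ∃ w ∈ W, finrank F (range (T (u + w))) ≤ ρ} →
      ∃ (U : Submodule F X) (K : Submodule F Y) (L : Submodule F Z),
        (∀ u ∈ U, ∀ y ∈ K, T u y ∈ L) ∧
        finrank F (X ⧸ U) + 4 ≤ max (2 * ρ) 1 * (finrank F W + 4) ∧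
        finrank F (Y ⧸ K) ≤ 4 * ρ ∧ finrank F L ≤ 4 * ρ := by
  have : FiniteDimensional F X := Module.Finite.of_finite
  induction ρ using Nat.strong_induction_on with
  | _ ρ ih =>
  intro Y Z _ _ _ _ _ _ T W hW
  set N := Fintype.card X with hN
  have hN0 : 0 < N := Fintype.card_pos
  rcases Nat.eq_zero_or_pos ρ with rfl | hρ
  · refine ⟨ker T, ⊤, ⊥, fun u hu y _ => by simp [LinearMap.mem_ker.1 hu], ?_, ?_, ?_⟩
    -- A proper subspace has density at most 1/2, but this one contains a set of density 7/8.
    · have htop : W ⊔ ker T = ⊤ := by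
        by_contra hne
        have hsub : #{u | ∃ w ∈ W, finrank F (range (T (u + w))) ≤ 0} ≤
            Fintype.card (W ⊔ ker T : Submodule F X) := by
          rw [Fintype.card_subtype]
          refine card_le_card fun u hu => ?_
          simp only [mem_filter, mem_univ, true_and] at hu ⊢
          obtain ⟨w, hw, h0⟩ := hu
          have h1 : range (T (u + w)) = ⊥ := Submodule.finrank_eq_zero.1 (Nat.le_zero.1 h0)
          have h2 : u + w ∈ ker T := LinearMap.mem_ker.2 (LinearMap.range_eq_bot.1 h1)
          have : u = -w + (u + w) := by abel
          rw [this]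
          exact Submodule.add_mem_sup (W.neg_mem hw) h2
        have h3 := Submodule.two_mul_card_le_of_ne_top hne
        rw [Nat.card_eq_fintype_card, Nat.card_eq_fintype_card] at h3
        omega
      have h1 := Submodule.finrank_add_le_finrank_add_finrank W (ker T)
      rw [htop, finrank_top] at h1
      have h2 := Submodule.finrank_quotient_add_finrank (ker T)
      simp only [mul_zero, zero_le, max_eq_right, one_mul]
      omega
    · have := Submodule.finrank_quotient_add_finrank (⊤ : Submodule F Y)
      rw [finrank_top] at this
      omega
    · simp
  by_cases hmin : 7 * N ≤ 8 * #{u | ∃ w ∈ W, finrank F (range (T (u + w))) ≤ ρ - 1}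
  · obtain ⟨U, K, L, h1, h2, h3, h4⟩ := ih (ρ - 1) (by omega) T W hmin
    refine ⟨U, K, L, h1, h2.trans ?_, by omega, by omega⟩
    exact Nat.mul_le_mul_right _ (by omega)
  -- Since ρ cannot be lowered, some whole coset of `W` has slices of rank at least ρ. This supplies
  -- the high-rank map `M` of the rank inequality.
  obtain ⟨x, hx⟩ : ∃ x, ∀ w ∈ W, ρ ≤ finrank F (range (T (x + w))) := by
    by_contra! hcon
    apply hmin
    rw [filter_true_of_mem, Finset.card_univ]
    · omega
    · intro u _
      obtain ⟨w, hw, h⟩ := hcon u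
      exact ⟨w, hw, by omega⟩
  set G : Finset X := {u | ∃ w ∈ W, finrank F (range (T (u + w))) ≤ ρ} with hG
  let A (v : X) : Finset X := {u | ∃ w ∈ W, finrank F (range (T (u + w))) ≤ ρ ∧
    finrank F (range (T (u + w) + T (x + v))) ≤ ρ}
  set S : Finset X := {u | u ∈ G ∧ x + u ∈ G} with hS
  have hScard : 6 * N ≤ 8 * #S := by
    have h1 : #({u | x + u ∈ G} : Finset X) = #G := by
      refine card_bij (fun u _ => x + u) (by simp) (by simp) fun b hb => ⟨b - x, ?_, ?_⟩
      · simpa using hb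
      · simp
    have h2 : S = G ∩ ({u | x + u ∈ G} : Finset X) := by ext; simp [hS]
    have h3 := card_union_add_card_inter G ({u | x + u ∈ G} : Finset X)
    have h4 := card_le_univ (G ∪ ({u | x + u ∈ G} : Finset X))
    rw [← h2, h1] at h3
    omega
  have hSA : S ⊆ (univ : Finset W).biUnion fun v => A v := by
    intro u hu
    simp only [hS, hG, mem_filter, mem_univ, true_and] at hu
    obtain ⟨⟨w, hw, h1⟩, w', hw', h2⟩ := hu
    simp only [mem_biUnion, mem_univ, true_and]
    refine ⟨⟨w' - w, W.sub_mem hw' hw⟩, ?_⟩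
    simp only [A, mem_filter, mem_univ, true_and]
    refine ⟨w, hw, h1, ?_⟩
    rw [← map_add]
    have : u + w + (x + (w' - w)) = x + u + w' := by abel
    rwa [this]
  set d := finrank F W with hd
  have hWcard : Fintype.card W = Fintype.card F ^ d := Module.card_eq_pow_finrank
  -- For `u ∈ S` the elements of `W` correcting `u` and `x + u` may differ. Pigeonholing on their
  -- difference `v` fixes `M = T (x + v)`, at the cost of a factor |W| in density.
  obtain ⟨⟨v, hv⟩, hvA⟩ : ∃ v : W, #S ≤ Fintype.card F ^ d * #(A v) := by
    by_contra! hcon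
    have h1 := (card_le_card hSA).trans card_biUnion_le
    have h2 : ∑ v : W, Fintype.card F ^ d * #(A v) < ∑ _v : W, #S :=
      sum_lt_sum_of_nonempty univ_nonempty fun v _ => hcon v
    rw [← mul_sum, sum_const, Finset.card_univ, hWcard, smul_eq_mul] at h2
    exact absurd (Nat.lt_of_mul_lt_mul_left h2) (not_lt.2 h1)
  simp only at hvA
  have hAne : (A v).Nonempty := by
    rw [← card_pos]
    by_contra h0
    have : #(A v) = 0 := by omega
    rw [this] at hvA
    omega
  set M := T (x + v) with hM
  have hMr : finrank F (range M) ≤ 2 * ρ := by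
    obtain ⟨u, hu⟩ := hAne
    simp only [A, mem_filter, mem_univ, true_and] at hu
    obtain ⟨w, hw, h1, h2⟩ := hu
    rw [← hM] at h2
    have h3 := finrank_range_sub_le (T (u + w) + M) (T (u + w))
    rw [add_sub_cancel_left] at h3
    omega
  let T' : X →ₗ[F] ker M →ₗ[F] (Z ⧸ range M) := (T.compl₂ (ker M).subtype).compr₂ (range M).mkQ
  have hT' (u : X) : T' u = (range M).mkQ ∘ₗ T u ∘ₗ (ker M).subtype := rfl
  -- Dimension `d` pays for the density lost to pigeonholing; the extra 4 gives a factor of at least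
  -- 16, leaving at most N/12 points uncovered, within the permitted N/8.
  obtain ⟨V, hVd, hV⟩ := exists_submodule_card_uncovered_le (F := F) (A v) (d + 4)
  have hgood : 7 * N ≤ 8 * #{u | ∃ w ∈ W ⊔ V, finrank F (range (T' (u + w))) ≤ ρ / 2} := by
    have hB := hV {u | ¬ ∃ w ∈ W ⊔ V, finrank F (range (T' (u + w))) ≤ ρ / 2} (by
      intro y hy z hz hyz
      simp only [mem_filter, mem_univ, true_and] at hy
      apply hy
      simp only [A, mem_filter, mem_univ, true_and] at hyz
      obtain ⟨w, hw, h1, h2⟩ := hyz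
      refine ⟨w + z, Submodule.add_mem_sup hw hz, ?_⟩
      have h3 := finrank_range_add_two_mul_le M (T (y + z + w))
      have h4 := hx v hv
      rw [← hM] at h2 h4
      have h5 : y + (w + z) = y + z + w := by abel
      rw [h5, hT']
      omega)
    set B := #{u | ¬ ∃ w ∈ W ⊔ V, finrank F (range (T' (u + w))) ≤ ρ / 2}
    have hq : 16 ≤ Fintype.card F ^ 4 := Nat.pow_le_pow_left Fintype.one_lt_card 4
    have h1 : 16 * (#S * B) ≤ N ^ 2 := by
      refine le_trans ?_ hB
      calc 16 * (#S * B) ≤ Fintype.card F ^ 4 * ((Fintype.card F ^ d * #(A v)) * B) := by gcongr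
        _ = _ := by ring
    have h2 : 12 * B ≤ N := by
      have : N * (12 * B) ≤ N * N := by nlinarith
      exact Nat.le_of_mul_le_mul_left this hN0
    have h3 := card_filter_add_card_filter_not (s := (univ : Finset X))
      (fun u => ∃ w ∈ W ⊔ V, finrank F (range (T' (u + w))) ≤ ρ / 2)
    rw [Finset.card_univ] at h3
    omega
  obtain ⟨U, K, L, h1, h2, h3, h4⟩ := ih (ρ / 2) (by omega) T' (W ⊔ V) hgood
  refine ⟨U, K.map (ker M).subtype, L.comap (range M).mkQ, ?_, ?_, ?_, ?_⟩
  · rintro u hu _ ⟨y, hy, rfl⟩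
    exact h1 u hu y hy
  · have h5 := Submodule.finrank_add_le_finrank_add_finrank W V
    calc finrank F (X ⧸ U) + 4 ≤ _ := h2
      -- The new auxiliary space has dimension at most `d + (d + 4)`, so `d + 4` exactly doubles at
      -- worst while ρ halves.
      _ ≤ max (2 * (ρ / 2)) 1 * (2 * (d + 4)) := Nat.mul_le_mul_left _ (by omega)
      _ = max (2 * (ρ / 2)) 1 * 2 * (d + 4) := by ring
      _ ≤ _ := Nat.mul_le_mul_right _ (by omega)
  -- Restricting to `ker M` costs rank `M` ≤ 2ρ, and the recursive call costs 4(ρ/2) ≤ 2ρ. The bound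
  -- on `L` splits in the same way.
  · have e1 := Submodule.finrank_quotient_add_finrank (K.map (ker M).subtype)
    have e2 := Submodule.finrank_quotient_add_finrank K
    have e3 := finrank_range_add_finrank_ker M
    rw [Submodule.finrank_map_subtype_eq] at e1
    omega
  · have e1 := Submodule.finrank_map_mkQ_add_finrank_inf (range M) (L.comap (range M).mkQ)
    rw [Submodule.map_comap_eq_of_surjective (Submodule.mkQ_surjective _)] at e1
    have e2 : finrank F (range M ⊓ L.comap (range M).mkQ : Submodule F Z) ≤ finrank F (range M) :=
      Submodule.finrank_mono inf_le_left
    omega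

end LowRank

/-! ### Finite differences and the trilinear form of a cubic -/

section Differences

open fwdDiff

variable {p : ℕ} {X : Type*} [AddCommGroup X]

theorem fwdDiff_add_step_apply {G : X → ZMod p} (hG : ∀ a b, Δ_[a] (Δ_[b] G) = 0) (a b x : X) :
    Δ_[a + b] G x = Δ_[a] G x + Δ_[b] G x := by
  have := congrFun (hG a b) x
  simp only [fwdDiff, Pi.zero_apply] at this ⊢
  rw [← add_assoc]
  linear_combination this

theorem fwdDiff_swap (a b : X) (G : X → ZMod p) : Δ_[a] (Δ_[b] G) = Δ_[b] (Δ_[a] G) := by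
  ext x
  simp only [fwdDiff, add_right_comm x a b]
  ring

variable [Fact p.Prime] [Module (ZMod p) X]

theorem exists_linearMap_of_fwdDiff_fwdDiff_eq_zero {G : X → ZMod p}
    (hG : ∀ a b, Δ_[a] (Δ_[b] G) = 0) :
    ∃ ψ : X →ₗ[ZMod p] ZMod p, ∀ x h, Δ_[h] G x = ψ h := by
  refine ⟨(AddMonoidHom.mk' (fun h => Δ_[h] G 0)
    fun a b => fwdDiff_add_step_apply hG a b 0).toZModLinearMap p, fun x h => ?_⟩
  have := congrFun (hG x h) 0
  simp only [fwdDiff, Pi.zero_apply, zero_add, AddMonoidHom.coe_toZModLinearMap,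
    AddMonoidHom.mk'_apply] at this ⊢
  linear_combination this

/-- The third difference of a function with vanishing fourth differences is trilinear. -/
theorem exists_trilinear_of_fwdDiff_eq_zero {f : X → ZMod p}
    (hf : ∀ a b c d, Δ_[a] (Δ_[b] (Δ_[c] (Δ_[d] f))) = 0) :
    ∃ T : X →ₗ[ZMod p] X →ₗ[ZMod p] X →ₗ[ZMod p] ZMod p,
      ∀ a b c x, Δ_[c] (Δ_[b] (Δ_[a] f)) x = T a b c := by
  have h3 (a b c d x : X) : Δ_[c + d] (Δ_[b] (Δ_[a] f)) x =
      Δ_[c] (Δ_[b] (Δ_[a] f)) x + Δ_[d] (Δ_[b] (Δ_[a] f)) x :=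
    fwdDiff_add_step_apply (fun _ _ => hf _ _ _ _) c d x
  have h2 (a b d c x : X) : Δ_[c] (Δ_[b + d] (Δ_[a] f)) x =
      Δ_[c] (Δ_[b] (Δ_[a] f)) x + Δ_[c] (Δ_[d] (Δ_[a] f)) x := by
    rw [fwdDiff_swap c (b + d), fwdDiff_swap c b, fwdDiff_swap c d, h3]
  have h1 (a d b c x : X) : Δ_[c] (Δ_[b] (Δ_[a + d] f)) x =
      Δ_[c] (Δ_[b] (Δ_[a] f)) x + Δ_[c] (Δ_[b] (Δ_[d] f)) x := by
    rw [fwdDiff_swap b (a + d), fwdDiff_swap b a, fwdDiff_swap b d, h2]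
  refine ⟨(AddMonoidHom.mk' (fun a => (AddMonoidHom.mk' (fun b => (AddMonoidHom.mk'
    (fun c => Δ_[c] (Δ_[b] (Δ_[a] f)) 0) fun c d => h3 a b c d 0).toZModLinearMap p)
    fun b d => LinearMap.ext fun c => h2 a b d c 0).toZModLinearMap p)
    fun a d => LinearMap.ext fun b => LinearMap.ext fun c => by
      simp only [AddMonoidHom.coe_toZModLinearMap, AddMonoidHom.mk'_apply, LinearMap.add_apply]
      exact h1 a d b c 0).toZModLinearMap p,
    fun a b c x => ?_⟩
  have := congrFun (hf x c b a) 0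
  simp only [AddMonoidHom.coe_toZModLinearMap, AddMonoidHom.mk'_apply]
  rw [fwdDiff, zero_add, Pi.zero_apply, sub_eq_zero] at this
  exact this

end Differences

/-! ### Van der Corput and exponential sums -/

section CharacterSums

open fwdDiff Finset ComplexConjugate

/-- Van der Corput's inequality with shifts restricted to `H`: average the sum over the shifts,
apply Cauchy–Schwarz, and use that the correlations depend only on the difference of two shifts. -/
theorem norm_sum_sq_mul_card_le {G H : Type*} [AddCommGroup G] [AddCommGroup H] [Fintype G]
    [Fintype H] (ι : H →+ G) (φ : G → ℂ) :
    ‖∑ z, φ z‖ ^ 2 * Fintype.card H ≤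
      Fintype.card G * ‖∑ h, ∑ z, φ (z + ι h) * conj (φ z)‖ := by
  have hH : (0 : ℝ) < Fintype.card H := by exact_mod_cast Fintype.card_pos
  have shift (h : H) : ∑ z, φ (z + ι h) = ∑ z, φ z := Equiv.sum_comp (Equiv.addRight (ι h)) φ
  have e1 : (Fintype.card H : ℂ) * ∑ z, φ z = ∑ z, ∑ h, φ (z + ι h) := by
    rw [sum_comm]
    simp [shift]
  have e2 : ((∑ z, ‖∑ h, φ (z + ι h)‖ ^ 2 : ℝ) : ℂ) =
      Fintype.card H * ∑ h, ∑ z, φ (z + ι h) * conj (φ z) := by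
    push_cast
    simp only [← Complex.mul_conj', map_sum, sum_mul_sum]
    rw [sum_comm]
    simp only [sum_comm (s := (univ : Finset G))]
    rw [sum_comm]
    have h2 (k : H) : ∑ h, ∑ z, φ (z + ι h) * conj (φ (z + ι k)) =
        ∑ h, ∑ z, φ (z + ι h) * conj (φ z) := by
      rw [← Equiv.sum_comp (Equiv.addRight k)]
      refine sum_congr rfl fun h _ => ?_
      rw [← Equiv.sum_comp (Equiv.addRight (ι k)) (fun z => φ (z + ι h) * conj (φ z))]
      refine sum_congr rfl fun z _ => ?_
      simp only [Equiv.coe_addRight, map_add, add_assoc, add_comm (ι k)]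
    simp only [h2, sum_const, Finset.card_univ, nsmul_eq_mul]
  have e3 : ∑ z, ‖∑ h, φ (z + ι h)‖ ^ 2 =
      Fintype.card H * ‖∑ h, ∑ z, φ (z + ι h) * conj (φ z)‖ := by
    rw [← abs_of_nonneg (sum_nonneg fun z _ => sq_nonneg ‖∑ h, φ (z + ι h)‖), ← Real.norm_eq_abs,
      ← Complex.norm_real, e2, norm_mul, Complex.norm_natCast]
  have e4 : (Fintype.card H * ‖∑ z, φ z‖) ^ 2 ≤
      Fintype.card G * ∑ z, ‖∑ h, φ (z + ι h)‖ ^ 2 := by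
    calc _ = ‖∑ z, ∑ h, φ (z + ι h)‖ ^ 2 := by rw [← e1, norm_mul, Complex.norm_natCast]
      _ ≤ (∑ z, ‖∑ h, φ (z + ι h)‖) ^ 2 := by gcongr; exact norm_sum_le _ _
      _ ≤ _ := by
        have := sq_sum_le_card_mul_sum_sq (s := (univ : Finset G))
          (f := fun z => ‖∑ h, φ (z + ι h)‖)
        rwa [Finset.card_univ] at this
  rw [e3] at e4
  refine le_of_mul_le_mul_left ?_ hH
  linarith

variable {p : ℕ} [Fact p.Prime] {X : Type*} [AddCommGroup X] [Fintype X]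

theorem stdAddChar_mul_conj (a b : ZMod p) :
    ZMod.stdAddChar a * conj (ZMod.stdAddChar b) = ZMod.stdAddChar (a - b) := by
  rw [AddChar.map_sub_eq_div, div_eq_mul_inv, ← AddChar.inv_apply_eq_conj]

theorem norm_sum_stdAddChar_sq_mul_card_le {H : Type*} [AddCommGroup H] [Fintype H] (ι : H →+ X)
    (f : X → ZMod p) :
    ‖∑ x, ZMod.stdAddChar (f x)‖ ^ 2 * Fintype.card H ≤
      Fintype.card X * ‖∑ h, ∑ x, ZMod.stdAddChar (Δ_[ι h] f x)‖ := by
  have := norm_sum_sq_mul_card_le ι (fun x => ZMod.stdAddChar (f x))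
  simp only [stdAddChar_mul_conj] at this
  exact this

variable [Module (ZMod p) X]

theorem sum_stdAddChar_eq_zero {G : X → ZMod p} (hG : ∀ a b, Δ_[a] (Δ_[b] G) = 0)
    (hne : ¬ ∀ x, G x = G 0) : ∑ x, ZMod.stdAddChar (G x) = 0 := by
  obtain ⟨ψ, hψ⟩ := exists_linearMap_of_fwdDiff_fwdDiff_eq_zero hG
  have h1 (x : X) : G x = G 0 + ψ x := by
    have := hψ 0 x
    simp only [fwdDiff, zero_add] at this
    linear_combination this
  have h2 : (ZMod.stdAddChar (N := p)).compAddMonoidHom ψ.toAddMonoidHom ≠ 0 := by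
    intro h0
    apply hne
    intro x
    have h3 : ZMod.stdAddChar (ψ x) = 1 := DFunLike.congr_fun h0 x
    have h4 : ψ x = 0 := ZMod.injective_stdAddChar (by rw [h3, AddChar.map_zero_eq_one])
    rw [h1 x, h4, add_zero]
  have h3 := AddChar.sum_eq_zero_of_ne_one h2
  rw [sum_congr rfl fun x _ => by rw [h1 x, AddChar.map_add_eq_mul], ← mul_sum]
  exact mul_eq_zero_of_right _ h3

/-- A biased function all of whose derivatives along `U` are affine is invariant under a large
subspace of `U`. -/
theorem exists_invariant_submodule {f : X → ZMod p} (U : Submodule (ZMod p) X)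
    (hU : ∀ u ∈ U, ∀ a b, Δ_[a] (Δ_[b] (Δ_[u] f)) = 0) {δ : ℝ} (hδ : 0 < δ)
    (hf : δ * Fintype.card X ≤ ‖∑ x, ZMod.stdAddChar (f x)‖) :
    ∃ R ≤ U, (∀ r ∈ R, ∀ x, f (x + r) = f x) ∧ δ ^ 2 * Nat.card U ≤ Nat.card R := by
  classical
  have hX : (0 : ℝ) < Fintype.card X := by exact_mod_cast Fintype.card_pos
  have hU0 : (0 : ℝ) < Fintype.card U := by exact_mod_cast Fintype.card_pos
  -- The directions in which the derivative is constant. The other directions in `U` have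
  -- nonconstant affine derivatives and contribute nothing to the van der Corput sum.
  let R' : AddSubgroup X :=
    { carrier := {r | r ∈ U ∧ ∀ x, Δ_[r] f x = Δ_[r] f 0}
      zero_mem' := ⟨U.zero_mem, by simp [fwdDiff]⟩
      add_mem' := by
        rintro a b ⟨ha, ha'⟩ ⟨hb, hb'⟩
        refine ⟨U.add_mem ha hb, fun x => ?_⟩
        have h1 := ha' (x + b)
        have h2 := ha' b
        have h3 := hb' x
        simp only [fwdDiff, zero_add] at *
        rw [add_comm a b, ← add_assoc]
        linear_combination h1 - h2 + h3
      neg_mem' := by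
        rintro a ⟨ha, ha'⟩
        refine ⟨U.neg_mem ha, fun x => ?_⟩
        have h1 := ha' (x + -a)
        have h2 := ha' (-a)
        simp only [fwdDiff, zero_add, neg_add_cancel, neg_add_cancel_right] at *
        linear_combination h2 - h1 }
  let R := AddSubgroup.toZModSubmodule p R'
  have hRU : R ≤ U := fun r hr => hr.1
  have hR (r : X) : r ∈ R ↔ r ∈ U ∧ ∀ x, Δ_[r] f x = Δ_[r] f 0 := Iff.rfl
  let lam : R →+ ZMod p := AddMonoidHom.mk' (fun r => Δ_[(r : X)] f 0) (by
    rintro ⟨a, ha⟩ ⟨b, hb⟩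
    have h1 := ((hR a).1 ha).2 b
    simp only [fwdDiff, zero_add, Submodule.coe_add] at *
    rw [add_comm a b]
    linear_combination h1)
  have lam_apply (r : R) : lam r = Δ_[(r : X)] f 0 := rfl
  have inner (u : U) : ∑ x, ZMod.stdAddChar (Δ_[(u : X)] f x) =
      if (u : X) ∈ R then (Fintype.card X : ℂ) * ZMod.stdAddChar (Δ_[(u : X)] f 0) else 0 := by
    split_ifs with h
    · simp [((hR _).1 h).2]
    · exact sum_stdAddChar_eq_zero (hU u u.2) fun h' => h ⟨u.2, h'⟩
  have total : ∑ u : U, ∑ x, ZMod.stdAddChar (Δ_[(u : X)] f x) =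
      (Fintype.card X : ℂ) * ∑ r : R, ZMod.stdAddChar (lam r) := by
    simp only [inner, lam_apply]
    rw [mul_sum, ← sum_filter]
    refine (sum_bij (fun (r : R) _ => (⟨r, hRU r.2⟩ : U)) (by simp) ?_ ?_ (by simp)).symm
    · intro a _ b _ h
      exact Subtype.ext (congrArg (fun u : U => (u : X)) h)
    · intro b hb
      exact ⟨⟨b, by simpa using hb⟩, mem_univ _, rfl⟩
  have main := norm_sum_stdAddChar_sq_mul_card_le U.subtype.toAddMonoidHom f
  have main' : δ ^ 2 * Fintype.card U ≤ ‖∑ r : R, ZMod.stdAddChar (lam r)‖ := by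
    have h1 : (δ * Fintype.card X) ^ 2 * Fintype.card U ≤
        Fintype.card X * (Fintype.card X * ‖∑ r : R, ZMod.stdAddChar (lam r)‖) := by
      refine le_trans ?_ (main.trans (le_of_eq ?_))
      · gcongr
      · have : ∑ u : U, ∑ x, ZMod.stdAddChar (Δ_[U.subtype.toAddMonoidHom u] f x) =
            (Fintype.card X : ℂ) * ∑ r : R, ZMod.stdAddChar (lam r) := total
        rw [this, norm_mul, Complex.norm_natCast]
    have h2 : (0 : ℝ) < Fintype.card X * Fintype.card X := by positivity
    refine le_of_mul_le_mul_left ?_ h2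
    linarith
  -- The constant derivatives form a character of `R`. Were it nontrivial, its sum would vanish,
  -- contradicting the positive lower bound `main'`.
  have hlam : ∀ r, lam r = 0 := by
    by_contra hne
    have : (ZMod.stdAddChar (N := p)).compAddMonoidHom lam ≠ 0 := by
      intro h0
      apply hne
      intro r
      have h3 : ZMod.stdAddChar (lam r) = 1 := DFunLike.congr_fun h0 r
      exact ZMod.injective_stdAddChar (by rw [h3, AddChar.map_zero_eq_one])
    have h3 : ∑ r : R, ZMod.stdAddChar (lam r) = 0 := AddChar.sum_eq_zero_of_ne_one this
    rw [h3, norm_zero] at main'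
    have : 0 < δ ^ 2 * Fintype.card U := by positivity
    linarith
  refine ⟨R, hRU, fun r hr x => ?_, ?_⟩
  · have h1 := ((hR r).1 hr).2 x
    have h2 := hlam ⟨r, hr⟩
    rw [lam_apply] at h2
    rw [h2] at h1
    exact sub_eq_zero.1 h1
  · rw [Nat.card_eq_fintype_card, Nat.card_eq_fintype_card]
    simpa [hlam] using main'

/-- Two van der Corput steps, joined by Cauchy–Schwarz, reach the second derivatives of `f`. These
are affine with linear part `T h k`, so only pairs with `T h k = 0` contribute. -/
theorem bias_pow_four_le {f : X → ZMod p} {T : X →ₗ[ZMod p] X →ₗ[ZMod p] X →ₗ[ZMod p] ZMod p}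
    (hT : ∀ a b c x, Δ_[c] (Δ_[b] (Δ_[a] f)) x = T a b c) {δ : ℝ} (hδ : 0 ≤ δ)
    (hf : δ * Fintype.card X ≤ ‖∑ x, ZMod.stdAddChar (f x)‖) :
    δ ^ 4 * Fintype.card X ^ 2 ≤ ∑ h, (Nat.card (LinearMap.ker (T h)) : ℝ) := by
  classical
  have hX : (0 : ℝ) < Fintype.card X := by exact_mod_cast Fintype.card_pos
  have vdc (g : X → ZMod p) : ‖∑ x, ZMod.stdAddChar (g x)‖ ^ 2 ≤
      ∑ h, ‖∑ x, ZMod.stdAddChar (Δ_[h] g x)‖ := by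
    have h1 := norm_sum_stdAddChar_sq_mul_card_le (AddMonoidHom.id X) g
    rw [mul_comm] at h1
    exact (le_of_mul_le_mul_left h1 hX).trans (norm_sum_le _ _)
  have inner (h k : X) : ‖∑ x, ZMod.stdAddChar (Δ_[k] (Δ_[h] f) x)‖ ≤
      if T h k = 0 then (Fintype.card X : ℝ) else 0 := by
    split_ifs with h0
    · refine (norm_sum_le _ _).trans ?_
      simp
    · rw [sum_stdAddChar_eq_zero, norm_zero]
      · intro a b
        ext x
        simp only [fwdDiff, Pi.zero_apply]
        have h1 := hT h k b (x + a)
        have h2 := hT h k b x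
        simp only [fwdDiff] at h1 h2
        linear_combination h1 - h2
      · intro hall
        apply h0
        ext c
        rw [← hT h k c 0, fwdDiff, hall, hall 0, sub_self]
        rfl
  have second (h : X) : ‖∑ x, ZMod.stdAddChar (Δ_[h] f x)‖ ^ 2 ≤
      Fintype.card X * Nat.card (LinearMap.ker (T h)) := by
    refine (vdc _).trans ((sum_le_sum fun k _ => inner h k).trans (le_of_eq ?_))
    rw [← sum_filter, sum_const, nsmul_eq_mul, mul_comm, Nat.card_eq_fintype_card,
      Fintype.card_subtype]
    simp only [LinearMap.mem_ker]
  have key : (δ * Fintype.card X) ^ 4 ≤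
      Fintype.card X * (Fintype.card X * ∑ h, (Nat.card (LinearMap.ker (T h)) : ℝ)) := by
    calc (δ * Fintype.card X) ^ 4 ≤ ‖∑ x, ZMod.stdAddChar (f x)‖ ^ 4 := by gcongr
      _ = (‖∑ x, ZMod.stdAddChar (f x)‖ ^ 2) ^ 2 := by ring
      _ ≤ (∑ h, ‖∑ x, ZMod.stdAddChar (Δ_[h] f x)‖) ^ 2 := by gcongr; exact vdc f
      _ ≤ Fintype.card X * ∑ h, ‖∑ x, ZMod.stdAddChar (Δ_[h] f x)‖ ^ 2 := by
        have := sq_sum_le_card_mul_sum_sq (s := (univ : Finset X))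
          (f := fun h => ‖∑ x, ZMod.stdAddChar (Δ_[h] f x)‖)
        rwa [Finset.card_univ] at this
      _ ≤ _ := by
        gcongr
        rw [mul_sum]
        exact sum_le_sum fun h _ => second h
  have h2 : (0 : ℝ) < Fintype.card X * Fintype.card X := by positivity
  refine le_of_mul_le_mul_left ?_ h2
  linarith

end CharacterSums

/-! ### Affine substitutions in polynomials -/

namespace MvPolynomial

variable {k σ τ ι : Type*} [Field k]

theorem aeval_eq_sum_multiset_prod (A : σ → MvPolynomial τ k) (f : MvPolynomial σ k) :
    aeval A f = ∑ s ∈ f.support, C (coeff s f) * (s.toMultiset.map A).prod := by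
  conv_lhs => rw [f.as_sum]
  rw [map_sum]
  refine Finset.sum_congr rfl fun s _ => ?_
  rw [aeval_monomial, Finsupp.toMultiset_map, Finsupp.prod_toMultiset, algebraMap_eq,
    Finsupp.prod_mapDomain_index (by simp) (by intros; exact pow_add _ _ _)]

theorem totalDegree_multiset_map_prod_le {A : σ → MvPolynomial τ k}
    (hA : ∀ i, (A i).totalDegree ≤ 1) (m : Multiset σ) :
    (m.map A).prod.totalDegree ≤ Multiset.card m := by
  refine (totalDegree_multiset_prod _).trans ?_
  rw [Multiset.map_map]
  refine (Multiset.sum_le_card_nsmul _ 1 ?_).trans (by simp)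
  intro x hx
  obtain ⟨i, -, rfl⟩ := Multiset.mem_map.1 hx
  exact hA i

theorem card_toMultiset_le_totalDegree {f : MvPolynomial σ k} {s : σ →₀ ℕ} (hs : s ∈ f.support) :
    Multiset.card s.toMultiset ≤ f.totalDegree := by
  rw [totalDegree_eq]
  exact Finset.le_sup (f := fun m => Multiset.card (Finsupp.toMultiset m)) hs

theorem totalDegree_aeval_le {A : σ → MvPolynomial τ k} (hA : ∀ i, (A i).totalDegree ≤ 1)
    (f : MvPolynomial σ k) : (aeval A f).totalDegree ≤ f.totalDegree := by
  rw [aeval_eq_sum_multiset_prod]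
  refine totalDegree_finsetSum_le fun s hs => (totalDegree_mul _ _).trans ?_
  rw [totalDegree_C, zero_add]
  exact (totalDegree_multiset_map_prod_le hA _).trans (card_toMultiset_le_totalDegree hs)

theorem eval_aeval (y : τ → k) (H : σ → MvPolynomial τ k) (f : MvPolynomial σ k) :
    eval y (aeval H f) = eval (fun i => eval y (H i)) f := by
  rw [← coe_aeval_eq_eval, RingHom.coe_coe, comp_aeval_apply, ← RingHom.coe_coe,
    coe_aeval_eq_eval]

variable [Fintype ι] {A B : σ → MvPolynomial τ k} {l : ι → MvPolynomial τ k} {c : ι → σ → k}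

/-- Telescoping: replacing one factor `A i` by `B i` at a time brings out the linear forms `l j`,
and each cofactor has one factor fewer. -/
theorem exists_multiset_prod_sub_eq (hA : ∀ i, (A i).totalDegree ≤ 1)
    (hB : ∀ i, (B i).totalDegree ≤ 1) (hAB : ∀ i, A i - B i = ∑ j, l j * C (c j i))
    (m : Multiset σ) : ∀ d, Multiset.card m ≤ d + 1 →
      ∃ q : ι → MvPolynomial τ k, (∀ j, (q j).totalDegree ≤ d) ∧
        (m.map A).prod - (m.map B).prod = ∑ j, l j * q j := by
  induction m using Multiset.induction with
  | empty => exact fun d _ => ⟨0, by simp, by simp⟩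
  | cons a m ih =>
    intro d hd
    rw [Multiset.card_cons, Nat.succ_le_succ_iff] at hd
    rcases Nat.eq_zero_or_pos d with rfl | hd0
    · obtain rfl := Multiset.card_eq_zero.1 (Nat.le_zero.1 hd)
      exact ⟨fun j => C (c j a), by simp, by simpa using hAB a⟩
    · obtain ⟨q, hq, h⟩ := ih (d - 1) (by omega)
      refine ⟨fun j => A a * q j + C (c j a) * (m.map B).prod, fun j => ?_, ?_⟩
      · refine (totalDegree_add _ _).trans (max_le ?_ ?_)
        · refine (totalDegree_mul _ _).trans ?_
          have := hA a
          have := hq j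
          omega
        · refine (totalDegree_mul _ _).trans ?_
          rw [totalDegree_C, zero_add]
          exact (totalDegree_multiset_map_prod_le hB m).trans hd
      · calc _ = A a * ((m.map A).prod - (m.map B).prod) + (A a - B a) * (m.map B).prod := by
              rw [Multiset.map_cons, Multiset.map_cons, Multiset.prod_cons, Multiset.prod_cons]
              ring
          _ = _ := by
              rw [h, hAB, Finset.mul_sum, Finset.sum_mul, ← Finset.sum_add_distrib]
              exact Finset.sum_congr rfl fun j _ => by ring

theorem exists_aeval_sub_aeval_eq (hA : ∀ i, (A i).totalDegree ≤ 1)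
    (hB : ∀ i, (B i).totalDegree ≤ 1) (hAB : ∀ i, A i - B i = ∑ j, l j * C (c j i))
    {f : MvPolynomial σ k} {d : ℕ} (hf : f.totalDegree ≤ d + 1) :
    ∃ q : ι → MvPolynomial τ k, (∀ j, (q j).totalDegree ≤ d) ∧
      aeval A f - aeval B f = ∑ j, l j * q j := by
  have (s : f.support) := exists_multiset_prod_sub_eq hA hB hAB s.1.toMultiset d
    ((card_toMultiset_le_totalDegree s.2).trans hf)
  choose q hq h using this
  refine ⟨fun j => ∑ s : f.support, C (coeff s.1 f) * q s j, fun j => ?_, ?_⟩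
  · refine totalDegree_finsetSum_le fun s _ => (totalDegree_mul _ _).trans ?_
    rw [totalDegree_C, zero_add]
    exact hq s j
  · rw [aeval_eq_sum_multiset_prod, aeval_eq_sum_multiset_prod, ← Finset.sum_sub_distrib,
      ← Finset.sum_coe_sort]
    simp only [Finset.mul_sum]
    rw [Finset.sum_comm]
    refine Finset.sum_congr rfl fun s _ => ?_
    rw [← mul_sub, h, Finset.mul_sum]
    exact Finset.sum_congr rfl fun j _ => by ring

theorem exists_fwdDiff_eval_eq (f : MvPolynomial σ k) {d : ℕ} (hf : f.totalDegree ≤ d + 1)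
    (h : σ → k) : ∃ g : MvPolynomial σ k, g.totalDegree ≤ d ∧
      fwdDiff h (fun x => eval x f) = fun x => eval x g := by
  -- Differencing compares the substitutions `x + h` and `x`. Their difference is constant, so the
  -- single form `l = 1` works and the cofactor is the derivative.
  obtain ⟨q, hq, e⟩ := exists_aeval_sub_aeval_eq (ι := Unit) (A := fun i => X i + C (h i))
    (B := X) (l := fun _ => 1) (c := fun _ i => h i)
    (fun i => (totalDegree_add _ _).trans (by simp)) (by simp) (by simp) hf
  refine ⟨q (), hq (), ?_⟩
  ext x
  have := congrArg (eval x) e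
  simp only [map_sub, Finset.univ_unique, Finset.sum_singleton, one_mul, aeval_X_left_apply] at this
  rw [eval_aeval] at this
  simp only [map_add, eval_X, eval_C] at this
  exact this

theorem fwdDiff_fwdDiff_fwdDiff_fwdDiff_eval_eq_zero (f : MvPolynomial σ k)
    (hf : f.totalDegree ≤ 3) (a b c d : σ → k) :
    fwdDiff a (fwdDiff b (fwdDiff c (fwdDiff d (fun x => eval x f)))) = 0 := by
  obtain ⟨f₁, h₁, e₁⟩ := exists_fwdDiff_eval_eq f hf d
  obtain ⟨f₂, h₂, e₂⟩ := exists_fwdDiff_eval_eq f₁ h₁ c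
  obtain ⟨f₃, h₃, e₃⟩ := exists_fwdDiff_eval_eq f₂ h₂ b
  rw [e₁, e₂, e₃, totalDegree_eq_zero_iff_eq_C.1 (Nat.le_zero.1 h₃)]
  ext x
  simp [fwdDiff]

theorem exists_affine {n : Type*} [Fintype n] (φ : (n → k) →ₗ[k] k) (c : k) :
    ∃ l : MvPolynomial n k, l.totalDegree ≤ 1 ∧ ∀ x, eval x l = φ x + c := by
  classical
  refine ⟨∑ i, C (φ (Pi.single i 1)) * X i + C c, ?_, fun x => ?_⟩
  · refine (totalDegree_add _ _).trans (max_le ?_ (by simp))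
    exact totalDegree_finsetSum_le fun i _ => (totalDegree_mul _ _).trans (by simp)
  · rw [map_add, map_sum, eval_C]
    congr 1
    conv_rhs => rw [LinearMap.pi_apply_eq_sum_univ φ x]
    exact Finset.sum_congr rfl fun i _ => by
      rw [map_mul, eval_C, eval_X, smul_eq_mul, mul_comm]
      congr 2
      ext j
      simp [Pi.single_apply, eq_comm]

end MvPolynomial

theorem Submodule.exists_sub_sum_smul_mem {k V : Type*} [Field k] [AddCommGroup V] [Module k V]
    [FiniteDimensional k V] (K : Submodule k V) :
    ∃ (l : Fin (finrank k (V ⧸ K)) → V →ₗ[k] k) (v : Fin (finrank k (V ⧸ K)) → V),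
      ∀ x, x - ∑ j, l j x • v j ∈ K := by
  let b := finBasis k (V ⧸ K)
  choose v hv using fun j => K.mkQ_surjective (b j)
  refine ⟨fun j => b.coord j ∘ₗ K.mkQ, v, fun x => ?_⟩
  rw [← Submodule.Quotient.mk_eq_zero, ← Submodule.mkQ_apply, map_sub, map_sum, sub_eq_zero]
  simp only [map_smul, hv, LinearMap.comp_apply, Basis.coord_apply]
  exact (b.sum_repr _).symm

/-! ### Decomposing a cubic along a coset -/

namespace MvPolynomial

/-- A cubic polynomial whose restriction to a coset of `K` is invariant under `R ≤ K` is a sum of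
`codim K` reducible cubics and a cubic polynomial in `dim K - dim R` affine functions. -/
theorem exists_decomposition {k : Type*} [Field k] {n : ℕ} (f : MvPolynomial (Fin n) k)
    (hf : f.totalDegree ≤ 3) (K : Submodule k (Fin n → k)) (a : Fin n → k) (R : Submodule k K)
    (hR : ∀ r ∈ R, ∀ z : K, eval (a + ((z + r : K) : Fin n → k)) f =
      eval (a + (z : Fin n → k)) f) :
    ∃ (l q : Fin (finrank k ((Fin n → k) ⧸ K)) → MvPolynomial (Fin n) k)
      (l' : Fin (finrank k (K ⧸ R)) → MvPolynomial (Fin n) k)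
      (g : MvPolynomial (Fin (finrank k (K ⧸ R))) k),
      (∀ j, (l j).totalDegree ≤ 1) ∧ (∀ j, (q j).totalDegree ≤ 2) ∧
      (∀ i, (l' i).totalDegree ≤ 1) ∧ g.totalDegree ≤ 3 ∧
      ∀ x, eval x f = (∑ j, eval x (l j) * eval x (q j)) + eval (fun i => eval x (l' i)) g := by
  obtain ⟨φ, v, hv⟩ := K.exists_sub_sum_smul_mem
  obtain ⟨ψ, w, hw⟩ := R.exists_sub_sum_smul_mem
  let κ : (Fin n → k) →ₗ[k] K := LinearMap.codRestrict K
    (LinearMap.id - ∑ j, (φ j).smulRight (v j)) (fun x => by simpa using hv x)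
  have hκ (x) : (κ x : Fin n → k) = x - ∑ j, φ j x • v j := by simp [κ]
  choose l hl hlx using fun j => exists_affine (φ j) (-φ j a)
  choose l' hl' hlx' using fun i => exists_affine (ψ i ∘ₗ κ) (-ψ i (κ a))
  -- `B` is the affine projection of the whole space onto the coset `a + K`. It differs from the
  -- identity by a combination of the `l j`, so `f - f ∘ B` is a sum of products `l j * q j`.
  let B (i : Fin n) : MvPolynomial (Fin n) k := X i - ∑ j, l j * C (v j i)
  have hB (i) : (B i).totalDegree ≤ 1 := by
    refine (totalDegree_sub _ _).trans (max_le (by simp) ?_)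
    refine totalDegree_finsetSum_le fun j _ => (totalDegree_mul _ _).trans ?_
    rw [totalDegree_C, add_zero]
    exact hl j
  have hBx (x) : (fun i => eval x (B i)) = a + κ (x - a) := by
    ext i
    rw [hκ]
    simp only [B, map_sub, map_sum, map_mul, eval_X, eval_C, hlx, Pi.add_apply, Pi.sub_apply,
      Finset.sum_apply, Pi.smul_apply, smul_eq_mul, ← sub_eq_add_neg]
    ring
  obtain ⟨q, hq, e⟩ := exists_aeval_sub_aeval_eq (A := X) (B := B) (l := l) (c := fun j i => v j i)
    (by simp) hB (by simp [B]) hf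
  let G (i : Fin n) : MvPolynomial (Fin (finrank k (K ⧸ R))) k :=
    ∑ j, C ((w j : Fin n → k) i) * X j + C (a i)
  have hG (i) : (G i).totalDegree ≤ 1 := by
    refine (totalDegree_add _ _).trans (max_le ?_ (by simp))
    exact totalDegree_finsetSum_le fun j _ => (totalDegree_mul _ _).trans (by simp)
  refine ⟨l, q, l', aeval G f, hl, hq, hl', (totalDegree_aeval_le hG f).trans hf, fun x => ?_⟩
  have h1 := congrArg (eval x) e
  rw [aeval_X_left_apply, map_sub, eval_aeval, hBx, map_sum, sub_eq_iff_eq_add] at h1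
  simp only [map_mul] at h1
  rw [h1, eval_aeval]
  congr 1
  have h2 : (fun i => eval (fun i => eval x (l' i)) (G i)) =
      a + (∑ j, ψ j (κ (x - a)) • w j : K) := by
    ext i
    simp only [G, map_add, map_sum, map_mul, eval_X, eval_C, hlx', Pi.add_apply,
      LinearMap.comp_apply, Submodule.coe_sum, Submodule.coe_smul, Finset.sum_apply,
      Pi.smul_apply, smul_eq_mul, sub_eq_add_neg, map_neg]
    rw [add_comm]
    congr 1
    exact Finset.sum_congr rfl fun j _ => mul_comm _ _
  -- Invariance under `R` allows a point of `K` to be replaced by its representative in the span of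
  -- the `w j`, whose coordinates are the values of the `l'`.
  have h3 := hR _ (hw (κ (x - a))) (∑ j, ψ j (κ (x - a)) • w j)
  rw [add_sub_cancel] at h3
  rw [h2, h3]

end MvPolynomial

/-! ### From bias to the decomposition -/

section Cubic

open fwdDiff Finset MvPolynomial

variable {p n : ℕ} [Fact p.Prime]

theorem MvPolynomial.exists_decomposition_of_vanishing (f : MvPolynomial (Fin n) (ZMod p))
    (hf : f.totalDegree ≤ 3)
    {T : (Fin n → ZMod p) →ₗ[ZMod p] (Fin n → ZMod p) →ₗ[ZMod p] (Fin n → ZMod p) →ₗ[ZMod p] ZMod p}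
    (hT : ∀ a b c x, Δ_[c] (Δ_[b] (Δ_[a] (fun x => eval x f))) x = T a b c)
    {K U : Submodule (ZMod p) (Fin n → ZMod p)}
    (hUK : ∀ u ∈ U, ∀ y ∈ K, ∀ z ∈ K, T u y z = 0) {δ : ℝ} (hδ : 0 < δ)
    (hbias : δ * Fintype.card (Fin n → ZMod p) ≤ ‖∑ x, ZMod.stdAddChar (eval x f)‖) :
    ∃ (c₂ : ℕ) (l q : Fin (finrank (ZMod p) ((Fin n → ZMod p) ⧸ K)) → MvPolynomial (Fin n) (ZMod p))
      (l' : Fin c₂ → MvPolynomial (Fin n) (ZMod p)) (g : MvPolynomial (Fin c₂) (ZMod p)),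
      δ ^ 2 * p ^ c₂ ≤ (p : ℝ) ^ finrank (ZMod p) ((Fin n → ZMod p) ⧸ U) ∧
      (∀ j, (l j).totalDegree ≤ 1) ∧ (∀ j, (q j).totalDegree ≤ 2) ∧
      (∀ i, (l' i).totalDegree ≤ 1) ∧ g.totalDegree ≤ 3 ∧
      ∀ x, eval x f = (∑ j, eval x (l j) * eval x (q j)) + eval (fun i => eval x (l' i)) g := by
  classical
  have hX : (0 : ℝ) < Fintype.card (Fin n → ZMod p) := by exact_mod_cast Fintype.card_pos
  have hp : (0 : ℝ) < p := by exact_mod_cast (Fact.out : p.Prime).pos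
  -- Averaging over translates: the sums over cosets of `K` cannot all be smaller than the global
  -- average.
  obtain ⟨a, ha⟩ : ∃ a : Fin n → ZMod p, δ * Fintype.card K ≤
      ‖∑ z : K, ZMod.stdAddChar (eval (a + (z : Fin n → ZMod p)) f)‖ := by
    by_contra! hcon
    have h1 : ∑ a : Fin n → ZMod p, ∑ z : K, ZMod.stdAddChar (eval (a + (z : Fin n → ZMod p)) f) =
        (Fintype.card K : ℂ) * ∑ x, ZMod.stdAddChar (eval x f) := by
      rw [sum_comm]
      have (z : K) : ∑ a : Fin n → ZMod p, ZMod.stdAddChar (eval (a + (z : Fin n → ZMod p)) f) =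
          ∑ x, ZMod.stdAddChar (eval x f) :=
        Equiv.sum_comp (Equiv.addRight (z : Fin n → ZMod p)) fun x => ZMod.stdAddChar (eval x f)
      simp only [this, sum_const, Finset.card_univ, nsmul_eq_mul]
    have h2 : ∑ a : Fin n → ZMod p, ‖∑ z : K, ZMod.stdAddChar (eval (a + (z : Fin n → ZMod p)) f)‖ <
        ∑ _a : Fin n → ZMod p, δ * Fintype.card K :=
      sum_lt_sum_of_nonempty univ_nonempty fun a _ => hcon a
    have h3 := norm_sum_le (univ : Finset (Fin n → ZMod p))
      fun a => ∑ z : K, ZMod.stdAddChar (eval (a + (z : Fin n → ZMod p)) f)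
    rw [h1, norm_mul, Complex.norm_natCast] at h3
    rw [sum_const, Finset.card_univ, nsmul_eq_mul] at h2
    have h4 : (Fintype.card K : ℝ) * (δ * Fintype.card (Fin n → ZMod p)) ≤
        Fintype.card K * ‖∑ x, ZMod.stdAddChar (eval x f)‖ := by gcongr
    linarith
  obtain ⟨R, hRU, hR, hcard⟩ := exists_invariant_submodule (f := fun z : K => eval (a + (z : Fin n → ZMod p)) f)
    (U.comap K.subtype) (fun u hu b c => by
      ext z
      have := hT u c b (a + z)
      rw [hUK u hu c c.2 b b.2] at this
      simp only [fwdDiff, Submodule.coe_add, ← add_assoc, Pi.zero_apply] at this ⊢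
      exact this) hδ ha
  obtain ⟨l, q, l', g, hl, hq, hl', hg, h⟩ := f.exists_decomposition hf K a R hR
  refine ⟨_, l, q, l', g, ?_, hl, hq, hl', hg, h⟩
  have e1 := Submodule.finrank_quotient_add_finrank R
  have e2 : finrank (ZMod p) K ≤
      finrank (ZMod p) (U.comap K.subtype) + finrank (ZMod p) ((Fin n → ZMod p) ⧸ U) := by
    have h1 := LinearMap.finrank_range_add_finrank_ker (U.mkQ ∘ₗ K.subtype)
    rw [LinearMap.ker_comp, Submodule.ker_mkQ] at h1
    have h2 := Submodule.finrank_le (LinearMap.range (U.mkQ ∘ₗ K.subtype))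
    omega
  rw [Module.natCard_eq_pow_finrank (K := ZMod p) (V := R),
    Module.natCard_eq_pow_finrank (K := ZMod p) (V := U.comap K.subtype), Nat.card_zmod] at hcard
  push_cast at hcard
  have hpos : 0 < (p : ℝ) ^ finrank (ZMod p) (U.comap K.subtype) := by positivity
  refine le_of_mul_le_mul_left ?_ hpos
  calc (p : ℝ) ^ finrank (ZMod p) (U.comap K.subtype) *
        (δ ^ 2 * (p : ℝ) ^ finrank (ZMod p) (K ⧸ R))
      = δ ^ 2 * (p : ℝ) ^ finrank (ZMod p) (U.comap K.subtype) * (p : ℝ) ^ finrank (ZMod p) (K ⧸ R) := by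
        ring
    _ ≤ (p : ℝ) ^ finrank (ZMod p) R * (p : ℝ) ^ finrank (ZMod p) (K ⧸ R) := by gcongr
    _ = (p : ℝ) ^ finrank (ZMod p) K := by rw [← pow_add, add_comm, e1]
    _ ≤ (p : ℝ) ^ (finrank (ZMod p) (U.comap K.subtype) + finrank (ZMod p) ((Fin n → ZMod p) ⧸ U)) :=
      pow_le_pow_right₀ (by exact_mod_cast (Fact.out : p.Prime).one_le) e2
    _ = _ := pow_add _ _ _

/-- A trilinear form with many zeros vanishes on large subspaces. -/
theorem exists_submodules_trilinear_eq_zero {F X : Type*} [Field F] [Fintype F] [AddCommGroup X]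
    [Module F X] [Fintype X] (T : X →ₗ[F] X →ₗ[F] X →ₗ[F] F) {η : ℝ} (hη : 0 < η)
    (hT : η * Fintype.card X ^ 2 ≤ ∑ h, (Nat.card (LinearMap.ker (T h)) : ℝ)) {ρ t : ℕ}
    (hρ : 2 < η * 2 ^ (ρ + 1)) (ht : 16 ≤ η * 2 ^ t) :
    ∃ U K : Submodule F X, (∀ u ∈ U, ∀ y ∈ K, ∀ z ∈ K, T u y z = 0) ∧
      finrank F (X ⧸ U) ≤ max (2 * ρ) 1 * (t + 4) ∧ finrank F (X ⧸ K) ≤ 8 * ρ := by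
  classical
  have : FiniteDimensional F X := Module.Finite.of_finite
  set N : ℝ := (Fintype.card X : ℝ) with hN
  have hN0 : 0 < N := by simpa [hN] using Fintype.card_pos (α := X)
  have hq : (2 : ℝ) ≤ Fintype.card F := by exact_mod_cast Fintype.one_lt_card (α := F)
  let A : Finset X := {h | η / 2 * N ≤ Nat.card (LinearMap.ker (T h))}
  have hA : η / 2 * N ≤ #A := by
    have h1 : ∑ h, (Nat.card (LinearMap.ker (T h)) : ℝ) ≤
        ∑ h, ((if h ∈ A then N else 0) + η / 2 * N) := by
      refine sum_le_sum fun h _ => ?_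
      split_ifs with hh
      · have h2 : Nat.card (LinearMap.ker (T h)) ≤ Nat.card X :=
        Finite.card_subtype_le _
        rw [Nat.card_eq_fintype_card (α := X)] at h2
        have : (Nat.card (LinearMap.ker (T h)) : ℝ) ≤ N := by rw [hN]; exact_mod_cast h2
        have : 0 ≤ η / 2 * N := by positivity
        linarith
      · have : Nat.card (LinearMap.ker (T h)) < η / 2 * N := by simpa [A] using hh
        linarith
    rw [sum_add_distrib, sum_ite_mem, univ_inter, sum_const, sum_const, Finset.card_univ,
      nsmul_eq_mul, nsmul_eq_mul, ← hN] at h1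
    have h2 : N * (η / 2 * N) ≤ N * #A := by linarith
    exact le_of_mul_le_mul_left h2 hN0
  -- Rank above ρ would bound the density of the kernel by 2^-(ρ+1), which is less than η/2.
  have hrank (h : X) (hh : h ∈ A) : finrank F (LinearMap.range (T h)) ≤ ρ := by
    have h1 : η / 2 * N ≤ Nat.card (LinearMap.ker (T h)) := by simpa [A] using hh
    by_contra! hlt
    rw [Module.natCard_eq_pow_finrank (K := F), Nat.card_eq_fintype_card] at h1
    have h2 := LinearMap.finrank_range_add_finrank_ker (T h)
    have h3 : N = (Fintype.card F : ℝ) ^ finrank F (LinearMap.range (T h)) *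
        (Fintype.card F : ℝ) ^ finrank F (LinearMap.ker (T h)) := by
      rw [← pow_add, h2, hN, Module.card_eq_pow_finrank (K := F) (V := X)]
      push_cast
      rfl
    have h4 : (2 : ℝ) ^ (ρ + 1) ≤ (Fintype.card F : ℝ) ^ finrank F (LinearMap.range (T h)) :=
      (pow_le_pow_left₀ (by norm_num) hq _).trans (pow_le_pow_right₀ (by linarith) hlt)
    have h5 : 2 * N < η * 2 ^ (ρ + 1) * N := by gcongr
    have h6 : 2 ^ (ρ + 1) * (η / 2 * N) ≤ N := by
      conv_rhs => rw [h3]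
      push_cast at h1
      gcongr
    linarith
  obtain ⟨W, hWd, hW⟩ := exists_submodule_card_uncovered_le (F := F) A t
  obtain ⟨U, K, L, h1, h2, h3, h4⟩ := LinearMap.exists_submodules_of_rank_le ρ T W (by
    have hB := hW {u | ¬ ∃ w ∈ W, finrank F (LinearMap.range (T (u + w))) ≤ ρ} (by
      intro y hy z hz hyz
      simp only [mem_filter, mem_univ, true_and] at hy
      exact hy ⟨z, hz, hrank _ hyz⟩)
    set B := #{u | ¬ ∃ w ∈ W, finrank F (LinearMap.range (T (u + w))) ≤ ρ}
    have h8 : 8 * B ≤ Fintype.card X := by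
      have hB' : (Fintype.card F : ℝ) ^ t * #A * B ≤ N ^ 2 := by rw [hN]; exact_mod_cast hB
      have h5 : N * (8 * B) ≤ N * N := by
        calc N * (8 * B) = 16 * (N / 2) * B := by ring
          _ ≤ η * 2 ^ t * (N / 2) * B := by gcongr
          _ = 2 ^ t * (η / 2 * N) * B := by ring
          _ ≤ (Fintype.card F : ℝ) ^ t * #A * B := by gcongr
          _ ≤ N * N := by rw [← sq]; exact hB'
      have h6 := le_of_mul_le_mul_left h5 hN0
      rw [hN] at h6
      exact_mod_cast h6
    have h9 := card_filter_add_card_filter_not (s := (univ : Finset X))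
      (fun u => ∃ w ∈ W, finrank F (LinearMap.range (T (u + w))) ≤ ρ)
    rw [Finset.card_univ] at h9
    omega)
  -- `T u y` lies in `L` for `y ∈ K`, so it vanishes on the common kernel of `L`; the intersection
  -- costs another 4ρ dimensions.
  refine ⟨U, K ⊓ L.dualCoannihilator, ?_, ?_, ?_⟩
  · intro u hu y hy z hz
    exact (Submodule.mem_dualCoannihilator z).1 hz.2 _ (h1 u hu y hy.1)
  · have : max (2 * ρ) 1 * (finrank F W + 4) ≤ max (2 * ρ) 1 * (t + 4) := by gcongr
    omega
  · have e1 := Submodule.finrank_quotient_add_finrank K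
    have e2 := Submodule.finrank_quotient_add_finrank (K ⊓ L.dualCoannihilator)
    have e3 : finrank F L + finrank F L.dualCoannihilator = finrank F X :=
      Subspace.finrank_add_finrank_dualCoannihilator_eq L
    have e4 := Submodule.finrank_sup_add_finrank_inf_eq K L.dualCoannihilator
    have e5 := Submodule.finrank_le (K ⊔ L.dualCoannihilator)
    omega

/-- If `T ≠ 0`, at most half of the `h` satisfy `T h = 0`, and every other kernel has density at
most 1/2. The total density is then at most 1/2 + 1/4. -/
theorem trilinear_eq_zero_of_card {F X : Type*} [Field F] [Fintype F] [AddCommGroup X]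
    [Module F X] [Fintype X] (T : X →ₗ[F] X →ₗ[F] X →ₗ[F] F) {η : ℝ} (hη : 3 / 4 < η)
    (hT : η * Fintype.card X ^ 2 ≤ ∑ h, (Nat.card (LinearMap.ker (T h)) : ℝ)) : T = 0 := by
  classical
  by_contra hne
  set N : ℝ := (Fintype.card X : ℝ) with hN
  have hN0 : 0 < N := by simpa [hN] using Fintype.card_pos (α := X)
  have half (W : Submodule F X) (hW : W ≠ ⊤) : (Nat.card W : ℝ) ≤ N / 2 := by
    have := Submodule.two_mul_card_le_of_ne_top hW
    rw [Nat.card_eq_fintype_card (α := X)] at this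
    have : (2 * Nat.card W : ℝ) ≤ N := by rw [hN]; exact_mod_cast this
    linarith
  have h1 (h : X) : (Nat.card (LinearMap.ker (T h)) : ℝ) ≤
      (if h ∈ LinearMap.ker T then N / 2 else 0) + N / 2 := by
    split_ifs with hh
    · have h2 : Nat.card (LinearMap.ker (T h)) ≤ Nat.card X :=
        Finite.card_subtype_le _
      rw [Nat.card_eq_fintype_card (α := X)] at h2
      have : (Nat.card (LinearMap.ker (T h)) : ℝ) ≤ N := by rw [hN]; exact_mod_cast h2
      linarith
    · have := half (LinearMap.ker (T h)) (by rwa [Ne, LinearMap.ker_eq_top])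
      linarith
  have h2 := hT.trans (sum_le_sum fun h _ => h1 h)
  have h3 : (#{h | h ∈ LinearMap.ker T} : ℝ) ≤ N / 2 := by
    rw [← Fintype.card_subtype, ← Nat.card_eq_fintype_card]
    exact half (LinearMap.ker T) (by rwa [Ne, LinearMap.ker_eq_top])
  rw [sum_add_distrib, ← sum_filter, sum_const, sum_const, Finset.card_univ, nsmul_eq_mul,
    nsmul_eq_mul, ← hN] at h2
  have h4 : (#{h | h ∈ LinearMap.ker T} : ℝ) * (N / 2) ≤ N / 2 * (N / 2) := by gcongr
  have h5 : 3 / 4 * N ^ 2 < η * N ^ 2 := by gcongr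
  nlinarith

theorem bias_mul_card (F : (Fin n → ZMod p) → ZMod p) :
    bias F * Fintype.card (Fin n → ZMod p) = ‖∑ x, ZMod.stdAddChar (F x)‖ := by
  have hp : (p : ℝ) ≠ 0 := by exact_mod_cast (Fact.out : p.Prime).ne_zero
  have h (j : ZMod p) : Complex.exp (2 * Real.pi * Complex.I / p) ^ j.val = ZMod.stdAddChar j := by
    rw [ZMod.stdAddChar_apply, ZMod.toCircle_apply, ← Complex.exp_nat_mul]
    congr 1
    ring
  have hc : (Fintype.card (Fin n → ZMod p) : ℝ) = (p : ℝ) ^ n := by simp [ZMod.card]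
  rw [bias, hc]
  simp only [h]
  rw [norm_div, norm_pow, Complex.norm_natCast, div_mul_cancel₀ _ (pow_ne_zero _ hp)]

theorem bias_le_one (F : (Fin n → ZMod p) → ZMod p) : bias F ≤ 1 := by
  have hX : (0 : ℝ) < Fintype.card (Fin n → ZMod p) := by exact_mod_cast Fintype.card_pos
  have h1 : ‖∑ x, ZMod.stdAddChar (F x)‖ ≤ Fintype.card (Fin n → ZMod p) :=
    (norm_sum_le _ _).trans (by simp)
  rw [← bias_mul_card] at h1
  exact le_of_mul_le_mul_right (by rwa [one_mul]) hX

end Cubic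

theorem mainTheorem1 :
    ∃ C₁ C₂ : ℝ, ∀ (p : ℕ) [Fact p.Prime] (n : ℕ) (f : MvPolynomial (Fin n) (ZMod p)) (δ : ℝ),
      f.totalDegree = 3 →
      bias (fun x => MvPolynomial.eval x f) = δ →
      0 < δ →
      ∃ (c₁ c₂ : ℕ)
        (l q : Fin c₁ → MvPolynomial (Fin n) (ZMod p))
        (l' : Fin c₂ → MvPolynomial (Fin n) (ZMod p))
        (g : MvPolynomial (Fin c₂) (ZMod p)),
        (c₁ : ℝ) ≤ C₁ * Real.log (1 / δ) ∧
        (c₂ : ℝ) ≤ C₂ * Real.log (1 / δ) ^ 4 ∧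
        (∀ j, (l j).totalDegree ≤ 1) ∧
        (∀ j, (q j).totalDegree ≤ 2) ∧
        (∀ i, (l' i).totalDegree ≤ 1) ∧
        g.totalDegree ≤ 3 ∧
        ∀ x : Fin n → ZMod p,
          MvPolynomial.eval x f =
            (∑ j, MvPolynomial.eval x (l j) * MvPolynomial.eval x (q j)) +
              MvPolynomial.eval (fun i => MvPolynomial.eval x (l' i)) g := by
  refine ⟨176, 6648 * 256, fun p _ n f δ hf hbias hδ => ?_⟩
  have hp2 : (2 : ℝ) ≤ p := by exact_mod_cast (Fact.out : p.Prime).two_le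
  have hp0 : (0 : ℝ) < p := by linarith
  have hδ1 : δ ≤ 1 := hbias ▸ bias_le_one _
  have hb : δ * Fintype.card (Fin n → ZMod p) ≤
      ‖∑ x, ZMod.stdAddChar (MvPolynomial.eval x f)‖ := by
    rw [← hbias]
    exact (bias_mul_card _).le
  obtain ⟨T, hT⟩ := exists_trilinear_of_fwdDiff_eq_zero
    (f.fwdDiff_fwdDiff_fwdDiff_fwdDiff_eval_eq_zero hf.le)
  have hker := bias_pow_four_le hT hδ.le hb
  have hlog : Real.log (1 / δ) = -Real.log δ := by rw [one_div, Real.log_inv]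
  set L := Real.log (1 / δ) with hL
  have hL0 : 0 ≤ L := by
    have := Real.log_nonpos hδ.le hδ1
    linarith
  have hlog2 := Real.log_two_gt_d9
  -- Near δ = 1 the logarithm tends to 0, so both counts must be exactly 0. Otherwise `L ≥ 1/16`,
  -- and additive constants can be absorbed into powers of `L`.
  rcases lt_or_ge (3 / 4) (δ ^ 4) with hbig | hsmall
  · have hT0 := trilinear_eq_zero_of_card T hbig hker
    obtain ⟨c₂, l, q, l', g, hc, h⟩ := f.exists_decomposition_of_vanishing hf.le hT
      (K := ⊤) (U := ⊤) (by simp [hT0]) hδ hb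
    have h0 : finrank (ZMod p) ((Fin n → ZMod p) ⧸ (⊤ : Submodule (ZMod p) (Fin n → ZMod p))) = 0 :=
      finrank_zero_of_subsingleton
    rw [h0, pow_zero] at hc
    have hc₂ : c₂ = 0 := by
      by_contra hne
      have h1 : (2 : ℝ) ≤ p ^ c₂ := hp2.trans (le_self_pow₀ (by linarith) hne)
      have h2 : δ ^ 4 ≤ δ ^ 2 := pow_le_pow_of_le_one hδ.le hδ1 (by norm_num)
      nlinarith
    refine ⟨_, c₂, l, q, l', g, ?_, ?_, h⟩
    · rw [h0, Nat.cast_zero]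
      positivity
    · rw [hc₂, Nat.cast_zero]
      positivity
  have hLlow : 1 / 16 ≤ L := by
    have h1 := Real.log_le_sub_one_of_pos (x := δ ^ 4) (by positivity)
    rw [Real.log_pow] at h1
    push_cast at h1
    linarith
  -- The slope 6 exceeds 4 / log 2, compensating for log δ⁴ = -4L; the constants 1 and 4 account for
  -- the thresholds 2 and 16.
  have hfloor := Nat.lt_floor_add_one (1 + 6 * L)
  have hfloor' := Nat.floor_le (a := 1 + 6 * L) (by positivity)
  have hceil := Nat.le_ceil (4 + 6 * L)
  have hceil' := Nat.ceil_lt_add_one (a := 4 + 6 * L) (by positivity)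
  set ρ := ⌊1 + 6 * L⌋₊
  set t := ⌈4 + 6 * L⌉₊
  have logs (m : ℕ) : Real.log (δ ^ 4 * 2 ^ m) = m * Real.log 2 - 4 * L := by
    rw [Real.log_mul (by positivity) (by positivity), Real.log_pow, Real.log_pow, hlog]
    push_cast
    ring
  obtain ⟨U, K, hUK, hU, hK⟩ := exists_submodules_trilinear_eq_zero T (ρ := ρ) (t := t)
    (pow_pos hδ 4) hker
    (by
      rw [← Real.log_lt_log_iff (by norm_num) (by positivity), logs]
      push_cast
      nlinarith)
    (by
      rw [← Real.log_le_log_iff (by norm_num) (by positivity), logs,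
        show (16 : ℝ) = 2 ^ 4 by norm_num, Real.log_pow]
      push_cast
      nlinarith)
  obtain ⟨c₂, l, q, l', g, hc, h⟩ := f.exists_decomposition_of_vanishing hf.le hT hUK hδ hb
  refine ⟨_, c₂, l, q, l', g, ?_, ?_, h⟩
  · have : (finrank (ZMod p) ((Fin n → ZMod p) ⧸ K) : ℝ) ≤ 8 * ρ := by exact_mod_cast hK
    linarith
  · set d := finrank (ZMod p) ((Fin n → ZMod p) ⧸ U)
    have h1 : (c₂ : ℝ) ≤ d + 3 * L := by
      have h2 := Real.log_le_log (by positivity) hc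
      rw [Real.log_mul (by positivity) (by positivity), Real.log_pow, Real.log_pow,
        Real.log_pow] at h2
      have h3 : Real.log 2 ≤ Real.log p := Real.log_le_log (by norm_num) hp2
      push_cast at h2
      by_contra! hlt
      have h4 : 3 * L * Real.log 2 ≤ (c₂ - d) * Real.log p :=
        mul_le_mul (by linarith) h3 (by linarith) (by linarith)
      nlinarith
    have h2 : (d : ℝ) ≤ (2 + 12 * L) * (9 + 6 * L) := by
      have h3 : (d : ℝ) ≤ max (2 * (ρ : ℝ)) 1 * ((t : ℝ) + 4) := by exact_mod_cast hU
      refine h3.trans (mul_le_mul (max_le ?_ ?_) ?_ ?_ ?_) <;> linarith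
    -- The bound 18 + 123L + 72L² is at most 6648L², since 18·256 + 123·16 + 72 = 6648; `h4` then
    -- raises L² to L⁴.
    have h3 : L ≤ 16 * L ^ 2 := by nlinarith
    have h4 : L ^ 2 ≤ 256 * L ^ 4 := by nlinarith [sq_nonneg L]
    nlinarith
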